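/- Let $X$ be a metric space. A subset $S\subset X$ admits a strong $\gamma$-Lipschitz contraction ($\gamma>0$) if there are a map $\phi:[0,1]\times S\to X$ and a point $x_0\in X$ such that $\phi(1,s)=s$ and $\phi(0,s)=x_0$ for all $s\in S$, and $$d(\phi(t,s),\phi(t',s'))\le \gamma\,\operatorname{diam}(S)\,|t-t'|+\gamma\, d(s,s')\qquad (t,t'\in[0,1],\ s,s'\in S).$$ The space $X$ admits locally strong Lipschitz contractions if for every $x\in X$ there are $r_x>0$ and $\gamma_x>0$ such that every subset $U$ of the open ball $B_{r_x}(x)$ admits a strong $\gamma_x$-Lipschitz contraction. For $k\ge 0$ let $C_k(X)$ be the free abelian group on the continuous maps $\Delta^k\to X$ (integral singular chains), with the usual boundary $b:C_k(X)\to C_{k-1}(X)$, where $C_{-1}(X)=0$, and let $C_k^L(X)\subset C_k(X)$ be the subgroup generated by the Lipschitz maps $\Delta^k\to X$. For a subset $A\subset X$, regard $C_k(A)\subset C_k(X)$ and $C_k^L(A)\subset C_k^L(X)$, and set $$H_k(X,A)=\frac{\{c\in C_k(X): bc\in C_{k-1}(A)\}}{\{c+b\bar c: c\in C_k(A),\ \bar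 c\in C_{k+1}(X)\}},\qquad H_k^L(X,A)=\frac{\{c\in C^L_k(X): bc\in C^L_{k-1}(A)\}}{\{c+b\bar c: c\in C^L_k(A),\ \bar c\in C^L_{k+1}(X)\}}.$$ **Corollary.** Let $X$ be a metric space and $A\subset X$ a subset such that $X$ and $A$ (with the restricted metric) both admit locally strong Lipschitz contractions. Then for every $k\ge 0$ the homomorphism $$H_k^L(X,A)\longrightarrow H_k(X,A)$$ induced by the inclusions of the Lipschitz chains into the singular chains is an isomorphism. -/

import Mathlib

noncomputable section

namespace LipHom

/-! ### Strong Lipschitz contractions -/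

/-- The subset `S` of the metric space `X` admits a strong `γ`-Lipschitz contraction: there are a map
`φ : [0,1] × S → X` and a point `x₀ : X` with `φ(1,s) = s`, `φ(0,s) = x₀` and
`d(φ(t,s), φ(t',s')) ≤ γ diam(S) |t - t'| + γ d(s,s')`.
This is used only for subsets of balls, which are bounded, so that `Metric.diam` is the diameter. -/
def StrongLipschitzContraction {X : Type*} [MetricSpace X] (γ : ℝ) (S : Set X) : Prop :=
  ∃ (φ : unitInterval → S → X) (x₀ : X),
    (∀ s : S, φ 1 s = s) ∧ (∀ s : S, φ 0 s = x₀) ∧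
    ∀ (t t' : unitInterval) (s s' : S),
      dist (φ t s) (φ t' s') ≤ γ * Metric.diam S * |(t : ℝ) - (t' : ℝ)| + γ * dist s s'

/-- The metric space `X` admits locally strong Lipschitz contractions: every point `x` has a radius
`r > 0` and a constant `γ > 0` such that every subset of the open ball of radius `r` about `x`
admits a strong `γ`-Lipschitz contraction (in `X`). -/
def LocallyStrongLipschitzContractions (X : Type*) [MetricSpace X] : Prop :=
  ∀ x : X, ∃ r : ℝ, 0 < r ∧ ∃ γ : ℝ, 0 < γ ∧
    ∀ U : Set X, U ⊆ Metric.ball x r → StrongLipschitzContraction γ U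

/-! ### Singular chains -/

/-- Singular `k`-simplices: continuous maps from the standard simplex
`Δ^k = {s ∈ ℝ^{k+1} | ∑ s_j = 1, 0 ≤ s_j}` to `X`. -/
abbrev Simplex (k : ℕ) (X : Type*) [TopologicalSpace X] : Type _ :=
  C(stdSimplex ℝ (Fin (k + 1)), X)

/-- Integral singular `k`-chains `C_k(X)`: the free abelian group on the singular `k`-simplices. -/
abbrev Chain (k : ℕ) (X : Type*) [TopologicalSpace X] : Type _ :=
  Simplex k X →₀ ℤ

/-- The `j`-th face inclusion `Δ^k → Δ^{k+1}`, the affine map onto `[e_0, …, ê_j, …, e_{k+1}]`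
which preserves the order of the vertices. -/
def faceMap (k : ℕ) (j : Fin (k + 2)) :
    C(stdSimplex ℝ (Fin (k + 1)), stdSimplex ℝ (Fin (k + 2))) :=
  ⟨stdSimplex.map j.succAbove, stdSimplex.continuous_map j.succAbove⟩

/-- The boundary `b : C_{k+1}(X) → C_k(X)`, `b σ = ∑_j (-1)^j σ|[e_0, …, ê_j, …, e_{k+1}]` on
simplices, extended linearly. (The boundary of a `0`-chain is zero; see `relCycles`.) -/
def boundary (X : Type*) [TopologicalSpace X] (k : ℕ) : Chain (k + 1) X →ₗ[ℤ] Chain k X :=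
  Finsupp.linearCombination ℤ fun σ : Simplex (k + 1) X =>
    ∑ j : Fin (k + 2), Finsupp.single (σ.comp (faceMap k j)) ((-1 : ℤ) ^ (j : ℕ))

/-- For `A ⊆ X`, the group `C_k(A)` of singular chains of `A`, as a subgroup of `C_k(X)`:
the chains all of whose simplices have image in `A`. -/
def chainsIn {X : Type*} [TopologicalSpace X] (A : Set X) (k : ℕ) : Submodule ℤ (Chain k X) :=
  Finsupp.supported ℤ ℤ {σ : Simplex k X | ∀ p, σ p ∈ A}

/-- For `A ⊆ X`, the group `C_k^L(A)` of singular Lipschitz chains of `A`, as a subgroup of `C_k(X)`: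
the chains all of whose simplices are Lipschitz maps with image in `A`. (The metric of `Δ^k` is here
the one of the maximum norm of `ℝ^{k+1}`; it is equivalent to the Euclidean one, so that the
Lipschitz maps on `Δ^k` are the same.) -/
def lipChainsIn {X : Type*} [MetricSpace X] (A : Set X) (k : ℕ) : Submodule ℤ (Chain k X) :=
  Finsupp.supported ℤ ℤ {σ : Simplex k X | (∃ K : NNReal, LipschitzWith K σ) ∧ ∀ p, σ p ∈ A}

/-! ### Relative homology -/

section

variable {X : Type*} [TopologicalSpace X]

/-- Relative cycles `{c ∈ C_k | b c ∈ D_{k-1}}`, where `D_{-1} = 0` and `b = 0` on `0`-chains. -/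
def relCycles (C D : ∀ k, Submodule ℤ (Chain k X)) : ∀ k, Submodule ℤ (Chain k X)
  | 0 => C 0
  | k + 1 => C (k + 1) ⊓ (D k).comap (boundary X k)

/-- Relative boundaries `{c + b c' | c ∈ D_k, c' ∈ C_{k+1}}`. -/
def relBoundaries (C D : ∀ k, Submodule ℤ (Chain k X)) (k : ℕ) : Submodule ℤ (Chain k X) :=
  D k ⊔ (C (k + 1)).map (boundary X k)

/-- Relative homology: relative cycles modulo relative boundaries. -/
abbrev RelHomology (C D : ∀ k, Submodule ℤ (Chain k X)) (k : ℕ) : Type _ :=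
  relCycles C D k ⧸ (relBoundaries C D k).submoduleOf (relCycles C D k)

/-- The cycles of a smaller pair of complexes are cycles of a larger one. -/
theorem relCycles_mono {C D C' D' : ∀ k, Submodule ℤ (Chain k X)}
    (hC : ∀ k, C k ≤ C' k) (hD : ∀ k, D k ≤ D' k) (k : ℕ) :
    relCycles C D k ≤ relCycles C' D' k := by
  cases k with
  | zero => exact hC 0
  | succ k => exact inf_le_inf (hC _) (Submodule.comap_mono (hD k))

/-- The boundaries of a smaller pair of complexes are boundaries of a larger one. -/
theorem relBoundaries_mono {C D C' D' : ∀ k, Submodule ℤ (Chain k X)}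
    (hC : ∀ k, C k ≤ C' k) (hD : ∀ k, D k ≤ D' k) (k : ℕ) :
    relBoundaries C D k ≤ relBoundaries C' D' k :=
  sup_le_sup (hD k) (Submodule.map_mono (hC (k + 1)))

/-- The homomorphism of relative homology groups induced by an inclusion of pairs of complexes:
the class of a cycle `c` is sent to the class of `c`. -/
def RelHomology.ofLE {C D C' D' : ∀ k, Submodule ℤ (Chain k X)}
    (hC : ∀ k, C k ≤ C' k) (hD : ∀ k, D k ≤ D' k) (k : ℕ) :
    RelHomology C D k →ₗ[ℤ] RelHomology C' D' k :=
  Submodule.mapQ _ _ (Submodule.inclusion (relCycles_mono hC hD k))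
    (fun _ hc => relBoundaries_mono hC hD k hc)

/-- Relative singular homology `H_k(X, A)` with integral coefficients. -/
abbrev SingularHomology (A : Set X) (k : ℕ) : Type _ :=
  RelHomology (X := X) (chainsIn Set.univ) (chainsIn A) k

end

section

variable {X : Type*} [MetricSpace X]

/-- Relative singular Lipschitz homology `H_k^L(X, A)` with integral coefficients. -/
abbrev LipschitzHomology (A : Set X) (k : ℕ) : Type _ :=
  RelHomology (X := X) (lipChainsIn Set.univ) (lipChainsIn A) k

/-- Lipschitz chains are singular chains. -/
theorem lipChainsIn_le (A : Set X) (k : ℕ) : lipChainsIn A k ≤ chainsIn A k :=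
  Finsupp.supported_mono fun _ h => h.2

/-- The comparison homomorphism `H_k^L(X, A) → H_k(X, A)` induced by the inclusion of the Lipschitz
chains into the singular chains. -/
def comparison (A : Set X) (k : ℕ) : LipschitzHomology A k →ₗ[ℤ] SingularHomology A k :=
  RelHomology.ofLE (lipChainsIn_le Set.univ) (lipChainsIn_le A) k

end

end LipHom

end

/-! The crux is that the quotient of singular by Lipschitz chains is acyclic, for `X` and for `A`: a
singular chain with Lipschitz boundary is a Lipschitz chain plus a boundary
(`LocallyStrongLipschitzContractions.relCycles_le`, transported to `A` by `relCycles_le_of_subset`).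
The isomorphism of relative groups then follows by a diagram chase.

For acyclicity, barycentric subdivision makes all simplices small without changing the class modulo
Lipschitz chains and boundaries, because subdivision and its chain homotopy preserve Lipschitz
chains. Small simplices lie in balls that contract with uniform constants. Coning along a Lipschitz
contraction keeps Lipschitz simplices Lipschitz and enlarges a ball only by a fixed factor
(`exists_coneOperator`).

The deformation `P` of `exists_deformation` is built by induction on dimension. For a small simplex
`σ`, the cycle `∂σ - ∂P∂σ` is Lipschitz, so a cone fills it by a Lipschitz chain `l`. Then `σ - l -
P∂σ` is a cycle, which a second cone fills by `Q`; set `Pσ = Q`. Hence `σ - ∂Pσ - P∂σ = l` is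
Lipschitz. If `∂c` is Lipschitz, so is `P∂c`, and therefore so is `c - ∂Pc`. -/

noncomputable section

namespace LipHom

open Finsupp

/-! ### The augmented complex of tuples -/

/-- Formal integral combinations of `n`-tuples in `V`. -/
abbrev Tup (n : ℕ) (V : Type*) : Type _ := (Fin n → V) →₀ ℤ

namespace Tup

variable {V W : Type*}

/-- The simplicial differential on tuples. -/
def d (n : ℕ) : Tup (n + 1) V →ₗ[ℤ] Tup n V :=
  linearCombination ℤ fun v => ∑ j : Fin (n + 1), single (v ∘ j.succAbove) ((-1 : ℤ) ^ (j : ℕ))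

/-- Adding a new zeroth vertex. -/
def cone (a : V) (n : ℕ) : Tup n V →ₗ[ℤ] Tup (n + 1) V :=
  lmapDomain ℤ ℤ fun v => (Fin.cons a v : Fin (n + 1) → V)

/-- Functoriality of tuples. -/
def push (f : V → W) (n : ℕ) : Tup n V →ₗ[ℤ] Tup n W :=
  lmapDomain ℤ ℤ fun v => f ∘ v

@[simp] theorem d_single (n : ℕ) (v : Fin (n + 1) → V) (a : ℤ) :
    d n (single v a) = a • ∑ j : Fin (n + 1), single (v ∘ j.succAbove) ((-1 : ℤ) ^ (j : ℕ)) := by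
  simp [d]

@[simp] theorem cone_single (a : V) (n : ℕ) (v : Fin n → V) (m : ℤ) :
    cone a n (single v m) = single (Fin.cons a v : Fin (n + 1) → V) m := by
  simp [cone]

@[simp] theorem push_single (f : V → W) (n : ℕ) (v : Fin n → V) (m : ℤ) :
    push f n (single v m) = single (f ∘ v) m := by
  simp [push]

/-- Deleting the apex returns `c`; deleting any other entry gives a cone over a face of `c`, with
the sign shifted by one. -/
theorem d_cone (a : V) (n : ℕ) (c : Tup (n + 1) V) :
    d (n + 1) (cone a (n + 1) c) = c - cone a n (d n c) := by
  induction c using Finsupp.induction_linear with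
  | zero => simp
  | add f g hf hg => simp only [map_add, hf, hg]; abel
  | single v m =>
    have h0 : (Fin.cons a v : Fin (n + 2) → V) ∘ (0 : Fin (n + 2)).succAbove = v := by
      ext i; simp
    have hs (j : Fin (n + 1)) : (Fin.cons a v : Fin (n + 2) → V) ∘ j.succ.succAbove
        = Fin.cons a (v ∘ j.succAbove) := by
      ext i; cases i using Fin.cases <;> simp
    simp only [cone_single, d_single, Fin.sum_univ_succ (n := n + 1), h0, hs, map_smul, map_sum,
      smul_add, Fin.val_zero, pow_zero, smul_single, smul_eq_mul, mul_one, Fin.val_succ, pow_succ,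
      mul_neg, single_neg, Finset.sum_neg_distrib, smul_neg, sub_eq_add_neg]

theorem d_cone_zero (a : V) (c : Tup 0 V) : d 0 (cone a 0 c) = c := by
  induction c using Finsupp.induction_linear with
  | zero => simp
  | add f g hf hg => simp only [map_add, hf, hg]
  | single v m =>
    simp

/-- A nonempty tuple is the cone from its first entry over its tail, so the cone formula reduces the
claim to shorter tuples and no double sum over faces is needed. -/
theorem d_d (n : ℕ) (c : Tup (n + 2) V) : d n (d (n + 1) c) = 0 := by
  induction c using Finsupp.induction_linear with
  | zero => simp
  | add f g hf hg => simp only [map_add, hf, hg, add_zero]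
  | single v m =>
    have hv : single v m = cone (v 0) (n + 1) (single (Fin.tail v) m) := by simp
    rw [hv, d_cone, map_sub]
    cases n with
    | zero => rw [d_cone_zero, sub_self]
    | succ n => rw [d_cone, d_d, map_zero, sub_zero, sub_self]

theorem d_push (f : V → W) (n : ℕ) (c : Tup (n + 1) V) :
    d n (push f (n + 1) c) = push f n (d n c) := by
  induction c using Finsupp.induction_linear with
  | zero => simp
  | add f g hf hg => simp only [map_add, hf, hg]
  | single v m => simp [Function.comp_assoc]

theorem cone_push (f : V → W) (a : V) (n : ℕ) (c : Tup n V) :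
    cone (f a) n (push f n c) = push f (n + 1) (cone a n c) := by
  induction c using Finsupp.induction_linear with
  | zero => simp
  | add f g hf hg => simp only [map_add, hf, hg]
  | single v m =>
    have : f ∘ (Fin.cons a v : Fin (n + 1) → V) = Fin.cons (f a) (f ∘ v) := by
      ext i; cases i using Fin.cases <;> simp
    simp [this]

/-- Barycentric subdivision with respect to a choice `β` of barycentres. -/
def sd (β : ∀ n, (Fin (n + 1) → V) → V) : ∀ n, Tup n V →ₗ[ℤ] Tup n V
  | 0 => LinearMap.id
  | n + 1 => linearCombination ℤ fun v => cone (β n v) n (sd β n (d n (single v 1)))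

/-- The chain homotopy between barycentric subdivision and the identity. -/
def homotopy (β : ∀ n, (Fin (n + 1) → V) → V) : ∀ n, Tup n V →ₗ[ℤ] Tup (n + 1) V
  | 0 => 0
  | n + 1 => linearCombination ℤ fun v =>
      cone (β n v) (n + 1) (single v 1 - homotopy β n (d n (single v 1)))

variable (β : ∀ n, (Fin (n + 1) → V) → V)

theorem sd_single (n : ℕ) (v : Fin (n + 1) → V) :
    sd β (n + 1) (single v 1) = cone (β n v) n (sd β n (d n (single v 1))) := by
  rw [sd, linearCombination_single, one_smul]

theorem homotopy_single (n : ℕ) (v : Fin (n + 1) → V) :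
    homotopy β (n + 1) (single v 1)
      = cone (β n v) (n + 1) (single v 1 - homotopy β n (d n (single v 1))) := by
  rw [homotopy, linearCombination_single, one_smul]

theorem induction_single {α M : Type*} [AddCommGroup M] {f g : (α →₀ ℤ) →ₗ[ℤ] M}
    (h : ∀ v, f (single v 1) = g (single v 1)) (c : α →₀ ℤ) : f c = g c := by
  have : f = g := by ext v; simpa using h v
  rw [this]

theorem d_sd (n : ℕ) (c : Tup (n + 1) V) : d n (sd β (n + 1) c) = sd β n (d n c) := by
  refine induction_single (f := d n ∘ₗ sd β (n + 1)) (g := sd β n ∘ₗ d n) (fun v => ?_) c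
  simp only [LinearMap.comp_apply]
  rw [sd_single]
  cases n with
  | zero => rw [d_cone_zero]
  | succ n => rw [d_cone, d_sd, d_d, map_zero, map_zero, sub_zero]

theorem d_homotopy (n : ℕ) (c : Tup (n + 1) V) :
    d (n + 1) (homotopy β (n + 1) c) + homotopy β n (d n c) = c - sd β (n + 1) c := by
  refine induction_single (f := d (n + 1) ∘ₗ homotopy β (n + 1) + homotopy β n ∘ₗ d n)
    (g := LinearMap.id - sd β (n + 1)) (fun v => ?_) c
  simp only [LinearMap.comp_apply, LinearMap.add_apply, LinearMap.sub_apply, LinearMap.id_apply]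
  rw [homotopy_single, d_cone, sd_single, map_sub]
  have : d n (single v 1) - d n (homotopy β n (d n (single v 1))) = sd β n (d n (single v 1)) := by
    cases n with
    | zero => simp [homotopy, sd]
    | succ n =>
      rw [eq_sub_of_add_eq (d_homotopy n _), d_d, map_zero]
      abel
  rw [this]
  abel

variable {β}

/-- Naturality under maps that preserve barycentres is what lets operators defined on one model
simplex act compatibly on all singular simplices. -/
theorem sd_push {β' : ∀ n, (Fin (n + 1) → W) → W} (f : V → W)
    (hf : ∀ n v, f (β n v) = β' n (f ∘ v)) (n : ℕ) (c : Tup n V) :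
    sd β' n (push f n c) = push f n (sd β n c) := by
  refine induction_single (f := sd β' n ∘ₗ push f n) (g := push f n ∘ₗ sd β n) (fun v => ?_) c
  simp only [LinearMap.comp_apply]
  cases n with
  | zero => rfl
  | succ n =>
    rw [push_single, sd_single, sd_single, ← cone_push, ← hf, ← sd_push f hf, ← d_push, push_single]

theorem homotopy_push {β' : ∀ n, (Fin (n + 1) → W) → W} (f : V → W)
    (hf : ∀ n v, f (β n v) = β' n (f ∘ v)) (n : ℕ) (c : Tup n V) :
    homotopy β' n (push f n c) = push f (n + 1) (homotopy β n c) := by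
  refine induction_single (f := homotopy β' n ∘ₗ push f n) (g := push f (n + 1) ∘ₗ homotopy β n)
    (fun v => ?_) c
  simp only [LinearMap.comp_apply]
  cases n with
  | zero => simp [homotopy]
  | succ n =>
    rw [push_single, homotopy_single, homotopy_single, ← cone_push, ← hf,
      map_sub (push f (n + 1)), ← homotopy_push f hf, ← d_push, push_single]

theorem map_mem_supported {α γ : Type*} {s : Set α} {t : Set γ} (f : (α →₀ ℤ) →ₗ[ℤ] (γ →₀ ℤ))
    (h : ∀ v ∈ s, f (single v 1) ∈ supported ℤ ℤ t) {c : α →₀ ℤ} (hc : c ∈ supported ℤ ℤ s) :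
    f c ∈ supported ℤ ℤ t := by
  rw [supported_eq_span_single] at hc
  have : Submodule.span ℤ ((fun i => single i (1 : ℤ)) '' s) ≤ (supported ℤ ℤ t).comap f := by
    rw [Submodule.span_le]
    rintro _ ⟨v, hv, rfl⟩
    exact h v hv
  exact this hc

/-- The tuples contained in every ball that contains the entries of `v`,
with mutual distances at most `r`. -/
def fine {n m : ℕ} [MetricSpace V] (v : Fin m → V) (r : ℝ) : Set (Fin n → V) :=
  {w | (∀ y ρ, (∀ j, dist (v j) y ≤ ρ) → ∀ i, dist (w i) y ≤ ρ) ∧ ∀ i j, dist (w i) (w j) ≤ r}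

/-- Induction on the length. New tuples have the barycentre as apex over a subdivided face. The ball
condition in `fine`, applied to balls centred at the barycentre, carries the bound `mesh` from the
entries of `v` to all entries of that face. -/
theorem sd_mem_fine [MetricSpace V] {k : ℕ} {l : ℝ} (hl : 0 ≤ l)
    (hull : ∀ n v y ρ, (∀ j, dist (v j) y ≤ ρ) → dist (β n v) y ≤ ρ)
    (mesh : ∀ n ≤ k, ∀ (v : Fin (n + 1) → V) (r : ℝ), (∀ i j, dist (v i) (v j) ≤ r) →
      ∀ j, dist (v j) (β n v) ≤ l * r)
    {n : ℕ} (hn : n ≤ k + 1) (v : Fin n → V) {r : ℝ} (hr : 0 ≤ r)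
    (hv : ∀ i j, dist (v i) (v j) ≤ r) :
    sd β n (single v 1) ∈ supported ℤ ℤ (fine v (l * r)) := by
  induction n with
  | zero => exact single_mem_supported ℤ _ ⟨fun _ _ _ i => i.elim0, fun i => i.elim0⟩
  | succ n ih =>
    rw [sd_single]
    simp only [d_single, map_sum, one_smul]
    refine Submodule.sum_mem _ fun j _ => ?_
    rw [← mul_one ((-1 : ℤ) ^ (j : ℕ)), ← smul_single', map_smul, map_smul]
    refine Submodule.smul_mem _ _ ?_
    refine map_mem_supported _ (fun w hw => ?_)
      (ih (by omega) (v ∘ j.succAbove) (fun i i' => hv _ _))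
    rw [cone_single]
    refine single_mem_supported ℤ _ ⟨fun y ρ h i => ?_, ?_⟩
    · cases i using Fin.cases with
      | zero => exact hull n v y ρ h
      | succ i => exact hw.1 y ρ (fun _ => h _) i
    · have key : ∀ i, dist (w i) (β n v) ≤ l * r :=
        fun i => hw.1 _ _ (fun _ => mesh n (by omega) v r hv _) i
      intro i i'
      cases i using Fin.cases with
      | zero =>
        cases i' using Fin.cases with
        | zero => simp only [dist_self]; positivity
        | succ i' => simpa [dist_comm] using key i'
      | succ i =>
        cases i' using Fin.cases with
        | zero => simpa using key i
        | succ i' => simpa using hw.2 i i'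

end Tup

open Tup

/-! ### Affine simplices and barycentric subdivision of singular chains -/

theorem faceMap_apply_self (k : ℕ) (j : Fin (k + 2)) (t : stdSimplex ℝ (Fin (k + 1))) :
    faceMap k j t j = 0 := by
  simp only [faceMap, ContinuousMap.coe_mk, stdSimplex.map_coe, FunOnFinite.linearMap_apply_apply]
  refine Finset.sum_eq_zero fun i hi => ?_
  simp at hi

theorem faceMap_apply_succAbove (k : ℕ) (j : Fin (k + 2)) (t : stdSimplex ℝ (Fin (k + 1)))
    (i : Fin (k + 1)) : faceMap k j t (j.succAbove i) = t i := by
  simp only [faceMap, ContinuousMap.coe_mk, stdSimplex.map_coe, FunOnFinite.linearMap_apply_apply]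
  simp [Finset.filter_eq']

/-- The affine map between standard simplices with prescribed values at the vertices. -/
def affine {n m : ℕ} (w : Fin (n + 1) → stdSimplex ℝ (Fin (m + 1))) :
    C(stdSimplex ℝ (Fin (n + 1)), stdSimplex ℝ (Fin (m + 1))) where
  toFun t := ⟨fun i => ∑ j, t j * w j i,
    fun i => Finset.sum_nonneg fun j _ => mul_nonneg (stdSimplex.zero_le t j) (stdSimplex.zero_le (w j) i), by
      rw [Finset.sum_comm]
      simp [← Finset.mul_sum]⟩
  continuous_toFun := by
    refine Continuous.subtype_mk (continuous_pi fun i => continuous_finsetSum _ fun j _ => ?_) _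
    exact ((continuous_apply j).comp continuous_subtype_val).mul continuous_const

section

variable {n m : ℕ}

theorem affine_apply (w : Fin (n + 1) → stdSimplex ℝ (Fin (m + 1)))
    (t : stdSimplex ℝ (Fin (n + 1))) (i : Fin (m + 1)) :
    affine w t i = ∑ j, t j * w j i := rfl

theorem affine_comp_faceMap (w : Fin (n + 2) → stdSimplex ℝ (Fin (m + 1))) (j : Fin (n + 2)) :
    (affine w).comp (faceMap n j) = affine (w ∘ j.succAbove) := by
  ext t i
  change affine w (faceMap n j t) i = affine (w ∘ j.succAbove) t i
  rw [affine_apply, affine_apply, Fin.sum_univ_succAbove _ j, faceMap_apply_self]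
  simp [faceMap_apply_succAbove]

theorem affine_affine {l : ℕ} (w : Fin (m + 1) → stdSimplex ℝ (Fin (l + 1)))
    (v : Fin (n + 1) → stdSimplex ℝ (Fin (m + 1))) (t : stdSimplex ℝ (Fin (n + 1))) :
    affine w (affine v t) = affine (affine w ∘ v) t := by
  ext i
  simp only [affine_apply, Function.comp_apply, Finset.sum_mul, Finset.mul_sum]
  rw [Finset.sum_comm]
  simp [mul_assoc]

/-- The vertices of the standard simplex. -/
def vertices (n : ℕ) : Fin (n + 1) → stdSimplex ℝ (Fin (n + 1)) := fun i => stdSimplex.vertex i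

theorem affine_vertices (t : stdSimplex ℝ (Fin (n + 1))) : affine (vertices n) t = t := by
  ext i
  rw [affine_apply]
  simp [vertices, Pi.single_apply]

theorem affine_comp_vertices (w : Fin (n + 1) → stdSimplex ℝ (Fin (m + 1))) :
    affine w ∘ vertices n = w := by
  ext j i
  change affine w (vertices n j) i = w j i
  rw [affine_apply]
  simp [vertices, Pi.single_apply]

theorem dist_le_iff_coord {ι : Type*} [Fintype ι] {s t : stdSimplex ℝ ι} {r : ℝ} (hr : 0 ≤ r) :
    dist s t ≤ r ↔ ∀ i, |s i - t i| ≤ r := by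
  rw [Subtype.dist_eq, dist_pi_le_iff hr]
  rfl

theorem abs_coord_sub_le {ι : Type*} [Fintype ι] (s t : stdSimplex ℝ ι) (i : ι) :
    |s i - t i| ≤ dist s t :=
  (dist_le_iff_coord dist_nonneg).1 le_rfl i

theorem dist_affine_le (w : Fin (n + 1) → stdSimplex ℝ (Fin (m + 1)))
    (t : stdSimplex ℝ (Fin (n + 1))) (y : stdSimplex ℝ (Fin (m + 1))) {r : ℝ}
    (h : ∀ j, dist (w j) y ≤ r) : dist (affine w t) y ≤ r := by
  have hr : 0 ≤ r := dist_nonneg.trans (h 0)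
  rw [dist_le_iff_coord hr]
  intro i
  have : affine w t i - y i = ∑ j, t j * (w j i - y i) := by
    simp [affine_apply, mul_sub, Finset.sum_sub_distrib, ← Finset.sum_mul]
  rw [this]
  calc |∑ j, t j * (w j i - y i)| ≤ ∑ j, |t j * (w j i - y i)| := Finset.abs_sum_le_sum_abs _ _
    _ ≤ ∑ j, t j * r := by
        refine Finset.sum_le_sum fun j _ => ?_
        rw [abs_mul, abs_of_nonneg (stdSimplex.zero_le t j)]
        exact mul_le_mul_of_nonneg_left ((abs_coord_sub_le _ _ i).trans (h j)) (stdSimplex.zero_le t j)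
    _ = r := by simp [← Finset.sum_mul]

theorem dist_affine_affine_le (w : Fin (n + 1) → stdSimplex ℝ (Fin (m + 1)))
    (s t : stdSimplex ℝ (Fin (n + 1))) {r : ℝ} (h : ∀ i j, dist (w i) (w j) ≤ r) :
    dist (affine w s) (affine w t) ≤ r := by
  refine dist_affine_le w s _ fun j => ?_
  rw [dist_comm]
  exact dist_affine_le w t _ fun i => h i j

theorem lipschitzWith_affine (w : Fin (n + 1) → stdSimplex ℝ (Fin (m + 1))) :
    LipschitzWith (n + 1 : ℕ) (affine w) := by
  refine LipschitzWith.of_dist_le_mul fun s t => ?_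
  rw [dist_le_iff_coord (by positivity)]
  intro i
  have : affine w s i - affine w t i = ∑ j, (s j - t j) * w j i := by
    simp [affine_apply, sub_mul, Finset.sum_sub_distrib]
  rw [this]
  calc |∑ j, (s j - t j) * w j i| ≤ ∑ j, |(s j - t j) * w j i| := Finset.abs_sum_le_sum_abs _ _
    _ ≤ ∑ _j : Fin (n + 1), dist s t := by
        refine Finset.sum_le_sum fun j _ => ?_
        rw [abs_mul, abs_of_nonneg (stdSimplex.zero_le (w j) i)]
        exact (mul_le_of_le_one_right (abs_nonneg _) (stdSimplex.le_one (w j) i)).trans (abs_coord_sub_le s t j)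
    _ = _ := by simp

/-- The barycentre of a tuple of points of a standard simplex. -/
def bary (m : ℕ) : ∀ n, (Fin (n + 1) → stdSimplex ℝ (Fin (m + 1))) → stdSimplex ℝ (Fin (m + 1)) :=
  fun _ v => affine v stdSimplex.barycenter

theorem affine_bary (w : Fin (n + 1) → stdSimplex ℝ (Fin (m + 1))) (l : ℕ)
    (v : Fin (l + 1) → stdSimplex ℝ (Fin (n + 1))) :
    affine w (bary n l v) = bary m l (affine w ∘ v) :=
  affine_affine w v _

/-- The difference from `v j` to the barycentre is a sum of `n` differences of vertices divided by
`n + 1`. The ratio `n / (n + 1)` is replaced by that of the top dimension `k` so that one factor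
serves for all faces. -/
theorem dist_bary_le {k : ℕ} (hn : n ≤ k) (v : Fin (n + 1) → stdSimplex ℝ (Fin (m + 1))) {r : ℝ}
    (hv : ∀ i j, dist (v i) (v j) ≤ r) (j : Fin (n + 1)) :
    dist (v j) (bary m n v) ≤ k / (k + 1) * r := by
  have hr : 0 ≤ r := dist_nonneg.trans (hv 0 0)
  rw [dist_le_iff_coord (by positivity)]
  intro i
  have : v j i - bary m n v i = (∑ l : Fin n, (v j i - v (j.succAbove l) i)) / (n + 1) := by
    have h1 : bary m n v i = (∑ l, v l i) / (n + 1) := by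
      have hb (l : Fin (n + 1)) : (stdSimplex.barycenter : stdSimplex ℝ (Fin (n + 1))) l
          = ((n : ℝ) + 1)⁻¹ := by
        change ((Fintype.card (Fin (n + 1)) : ℝ))⁻¹ = _
        simp
      simp only [bary, affine_apply, hb, div_eq_inv_mul, Finset.mul_sum]
    rw [h1, Fin.sum_univ_succAbove _ j, Finset.sum_sub_distrib]
    simp only [Finset.sum_const, Finset.card_univ, Fintype.card_fin, nsmul_eq_mul]
    field_simp
    ring
  rw [this, abs_div, abs_of_pos (by positivity : (0 : ℝ) < n + 1)]
  have h2 : |∑ l : Fin n, (v j i - v (j.succAbove l) i)| ≤ n * r := by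
    refine (Finset.abs_sum_le_sum_abs _ _).trans ?_
    refine (Finset.sum_le_sum fun l _ => (abs_coord_sub_le _ _ i).trans (hv _ _)).trans ?_
    simp
  have h3 : (n : ℝ) / (n + 1) ≤ k / (k + 1) := by
    have : (n : ℝ) ≤ k := by exact_mod_cast hn
    rw [div_le_div_iff₀ (by positivity) (by positivity)]
    nlinarith
  calc |∑ l : Fin n, (v j i - v (j.succAbove l) i)| / (n + 1) ≤ n * r / (n + 1) := by gcongr
    _ = n / (n + 1) * r := by ring
    _ ≤ _ := by gcongr

end

/-! ### Subdivision operators on singular chains, transported from tuples -/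

section

variable {X : Type*} [TopologicalSpace X]

/-- The singular chain obtained from affine simplices in the domain of `σ`. -/
def realize {m : ℕ} (σ : Simplex m X) (k : ℕ) :
    Tup (k + 1) (stdSimplex ℝ (Fin (m + 1))) →ₗ[ℤ] Chain k X :=
  lmapDomain ℤ ℤ fun w => σ.comp (affine w)

@[simp] theorem realize_single {m : ℕ} (σ : Simplex m X) (k : ℕ)
    (w : Fin (k + 1) → stdSimplex ℝ (Fin (m + 1))) (a : ℤ) :
    realize σ k (single w a) = single (σ.comp (affine w)) a := by
  simp [realize]

theorem boundary_single (k : ℕ) (σ : Simplex (k + 1) X) :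
    boundary X k (single σ 1)
      = ∑ j : Fin (k + 2), single (σ.comp (faceMap k j)) ((-1 : ℤ) ^ (j : ℕ)) := by
  simp [boundary]

theorem boundary_realize {m : ℕ} (σ : Simplex m X) (k : ℕ)
    (c : Tup (k + 2) (stdSimplex ℝ (Fin (m + 1)))) :
    boundary X k (realize σ (k + 1) c) = realize σ k (d (k + 1) c) := by
  refine induction_single (f := boundary X k ∘ₗ realize σ (k + 1))
    (g := realize σ k ∘ₗ d (k + 1)) (fun w => ?_) c
  simp [boundary_single, ContinuousMap.comp_assoc, affine_comp_faceMap]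

/-- Every generator is thus realized by a tuple in its own domain, which reduces identities between
operators on singular chains to identities on tuples. -/
theorem realize_vertices {k : ℕ} (σ : Simplex k X) :
    realize σ k (single (vertices k) 1) = single σ 1 := by
  have : σ.comp (affine (vertices k)) = σ := by ext t; simp [affine_vertices]
  rw [realize_single, this]

theorem realize_comp_affine {m l : ℕ} (σ : Simplex m X)
    (w : Fin (l + 1) → stdSimplex ℝ (Fin (m + 1))) (k : ℕ)
    (c : Tup (k + 1) (stdSimplex ℝ (Fin (l + 1)))) :
    realize (σ.comp (affine w)) k c = realize σ k (push (affine w) (k + 1) c) := by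
  refine induction_single (f := realize (σ.comp (affine w)) k)
    (g := realize σ k ∘ₗ push (affine w) (k + 1)) (fun v => ?_) c
  have : (affine w).comp (affine v) = affine (affine w ∘ v) := by ext t : 1; exact affine_affine w v t
  simp [ContinuousMap.comp_assoc, this]

theorem boundary_boundary (k : ℕ) (c : Chain (k + 2) X) :
    boundary X k (boundary X (k + 1) c) = 0 := by
  refine induction_single (f := boundary X k ∘ₗ boundary X (k + 1)) (g := 0) (fun σ => ?_) c
  rw [LinearMap.comp_apply, ← realize_vertices, boundary_realize, boundary_realize, d_d, map_zero]
  rfl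

/-- Barycentric subdivision of singular chains. -/
def subdivision (k : ℕ) : Chain k X →ₗ[ℤ] Chain k X :=
  linearCombination ℤ fun σ => realize σ k (sd (bary k) (k + 1) (single (vertices k) 1))

/-- The chain homotopy between barycentric subdivision and the identity. -/
def subdivisionHomotopy (k : ℕ) : Chain k X →ₗ[ℤ] Chain (k + 1) X :=
  linearCombination ℤ fun σ => realize σ (k + 1) (homotopy (bary k) (k + 1) (single (vertices k) 1))

/-- Affine maps preserve barycentres, so subdividing in the domain of `σ.comp (affine w)` agrees
with subdividing the tuple `w` in the domain of `σ`. -/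
theorem subdivision_realize {m : ℕ} (σ : Simplex m X) (k : ℕ)
    (c : Tup (k + 1) (stdSimplex ℝ (Fin (m + 1)))) :
    subdivision k (realize σ k c) = realize σ k (sd (bary m) (k + 1) c) := by
  refine induction_single (f := subdivision k ∘ₗ realize σ k)
    (g := realize σ k ∘ₗ sd (bary m) (k + 1)) (fun w => ?_) c
  simp only [LinearMap.comp_apply, realize_single, subdivision, linearCombination_single, one_smul]
  rw [realize_comp_affine, ← sd_push (affine w) (affine_bary w), push_single, affine_comp_vertices]

theorem subdivisionHomotopy_realize {m : ℕ} (σ : Simplex m X) (k : ℕ)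
    (c : Tup (k + 1) (stdSimplex ℝ (Fin (m + 1)))) :
    subdivisionHomotopy k (realize σ k c) = realize σ (k + 1) (homotopy (bary m) (k + 1) c) := by
  refine induction_single (f := subdivisionHomotopy k ∘ₗ realize σ k)
    (g := realize σ (k + 1) ∘ₗ homotopy (bary m) (k + 1)) (fun w => ?_) c
  simp only [LinearMap.comp_apply, realize_single, subdivisionHomotopy, linearCombination_single,
    one_smul]
  rw [realize_comp_affine, ← homotopy_push (affine w) (affine_bary w), push_single,
    affine_comp_vertices]

theorem boundary_subdivision (k : ℕ) (c : Chain (k + 1) X) :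
    boundary X k (subdivision (k + 1) c) = subdivision k (boundary X k c) := by
  refine induction_single (f := boundary X k ∘ₗ subdivision (k + 1))
    (g := subdivision k ∘ₗ boundary X k) (fun σ => ?_) c
  simp only [LinearMap.comp_apply]
  rw [← realize_vertices, subdivision_realize, boundary_realize, boundary_realize,
    subdivision_realize, d_sd]

theorem boundary_subdivisionHomotopy (k : ℕ) (c : Chain (k + 1) X) :
    boundary X (k + 1) (subdivisionHomotopy (k + 1) c) + subdivisionHomotopy k (boundary X k c)
      = c - subdivision (k + 1) c := by
  refine induction_single
    (f := boundary X (k + 1) ∘ₗ subdivisionHomotopy (k + 1) + subdivisionHomotopy k ∘ₗ boundary X k)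
    (g := LinearMap.id - subdivision (k + 1)) (fun σ => ?_) c
  simp only [LinearMap.comp_apply, LinearMap.add_apply, LinearMap.sub_apply, LinearMap.id_apply]
  rw [← realize_vertices, subdivision_realize, boundary_realize, subdivisionHomotopy_realize,
    subdivisionHomotopy_realize, boundary_realize, ← map_add, d_homotopy, map_sub]

theorem boundary_subdivisionHomotopy_zero (c : Chain 0 X) :
    boundary X 0 (subdivisionHomotopy 0 c) = c - subdivision 0 c := by
  refine induction_single (f := boundary X 0 ∘ₗ subdivisionHomotopy 0)
    (g := LinearMap.id - subdivision 0) (fun σ => ?_) c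
  simp only [LinearMap.comp_apply, LinearMap.sub_apply, LinearMap.id_apply]
  rw [← realize_vertices, subdivision_realize, subdivisionHomotopy_realize, boundary_realize,
    eq_sub_of_add_eq (d_homotopy _ 0 _)]
  simp [homotopy]

end

/-! ### Lipschitz chains and small chains under subdivision -/

section

variable {X : Type*} [MetricSpace X]

theorem realize_mem_lipChainsIn {A : Set X} {m : ℕ} {σ : Simplex m X}
    (hσ : (∃ K : NNReal, LipschitzWith K σ) ∧ ∀ p, σ p ∈ A) (k : ℕ)
    (c : Tup (k + 1) (stdSimplex ℝ (Fin (m + 1)))) : realize σ k c ∈ lipChainsIn A k := by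
  obtain ⟨⟨K, hK⟩, hA⟩ := hσ
  refine map_mem_supported (s := Set.univ) _ (fun w _ => ?_) (by simp [supported_univ])
  rw [realize_single]
  exact single_mem_supported ℤ _ ⟨⟨_, hK.comp (lipschitzWith_affine w)⟩, fun p => hA _⟩

theorem subdivision_mem_lipChainsIn {A : Set X} {k : ℕ} {c : Chain k X}
    (hc : c ∈ lipChainsIn A k) : subdivision k c ∈ lipChainsIn A k := by
  refine map_mem_supported _ (fun σ hσ => ?_) hc
  rw [subdivision, linearCombination_single, one_smul]
  exact realize_mem_lipChainsIn hσ _ _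

theorem subdivisionHomotopy_mem_lipChainsIn {A : Set X} {k : ℕ} {c : Chain k X}
    (hc : c ∈ lipChainsIn A k) : subdivisionHomotopy k c ∈ lipChainsIn A (k + 1) := by
  refine map_mem_supported _ (fun σ hσ => ?_) hc
  rw [subdivisionHomotopy, linearCombination_single, one_smul]
  exact realize_mem_lipChainsIn hσ _ _

/-- The chains of simplices in `K` whose images have diameter at most `ε`. -/
def smallChains (K : Set X) (ε : ℝ) (k : ℕ) : Submodule ℤ (Chain k X) :=
  supported ℤ ℤ {σ : Simplex k X | (∀ p, σ p ∈ K) ∧ ∀ p q, dist (σ p) (σ q) ≤ ε}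

/-- All iterates are realized from the one domain of `σ`, so the mesh estimate takes place in the
standard simplex, whose vertices have mutual distance at most `1`. -/
theorem iterate_subdivision_single {k : ℕ} (σ : Simplex k X) (N : ℕ) :
    ∃ c ∈ supported ℤ ℤ {w : Fin (k + 1) → stdSimplex ℝ (Fin (k + 1)) |
        ∀ i j, dist (w i) (w j) ≤ ((k : ℝ) / (k + 1)) ^ N},
      (subdivision k)^[N] (single σ 1) = realize σ k c := by
  induction N with
  | zero =>
    refine ⟨single (vertices k) 1, single_mem_supported ℤ _ fun i j => ?_, ?_⟩
    · rw [pow_zero, dist_le_iff_coord zero_le_one]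
      intro l
      have h1 := stdSimplex.zero_le (vertices k i) l
      have h2 := stdSimplex.le_one (vertices k i) l
      have h3 := stdSimplex.zero_le (vertices k j) l
      have h4 := stdSimplex.le_one (vertices k j) l
      rw [abs_le]; constructor <;> linarith
    · exact (realize_vertices σ).symm
  | succ N ih =>
    obtain ⟨c, hc, h⟩ := ih
    refine ⟨sd (bary k) (k + 1) c, ?_, ?_⟩
    · refine map_mem_supported _ (fun w hw => ?_) hc
      refine supported_mono ?_ (sd_mem_fine (k := k) (l := (k : ℝ) / (k + 1)) (by positivity)
        (fun n v y ρ h => dist_affine_le v _ y h) (fun n hn v r h j => dist_bary_le hn v h j)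
        le_rfl w (r := ((k : ℝ) / (k + 1)) ^ N) (by positivity) hw)
      intro v hv
      rw [Set.mem_ofPred_eq, pow_succ']
      exact hv.2
    · rw [Function.iterate_succ_apply', h, subdivision_realize]

theorem exists_iterate_subdivision_mem_smallChains {K : Set X} {k : ℕ} {c : Chain k X}
    (hc : c ∈ chainsIn K k) {ε : ℝ} (hε : 0 < ε) :
    ∃ N, (subdivision k)^[N] c ∈ smallChains K ε k := by
  have hev : ∀ σ ∈ c.support, ∀ᶠ N in Filter.atTop,
      (subdivision k)^[N] (single σ 1) ∈ smallChains K ε k := by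
    intro σ hσ
    have hσK : ∀ p, σ p ∈ K := (mem_supported ℤ c).1 hc hσ
    obtain ⟨η, hη, hu⟩ := Metric.uniformContinuous_iff.1
      (CompactSpace.uniformContinuous_of_continuous σ.continuous) ε hε
    have hlt : (k : ℝ) / (k + 1) < 1 := by
      rw [div_lt_one (by positivity)]; linarith
    filter_upwards [(tendsto_pow_atTop_nhds_zero_of_lt_one (by positivity) hlt).eventually
      (gt_mem_nhds hη)] with N hN
    obtain ⟨a, ha, h⟩ := iterate_subdivision_single σ N
    rw [h]
    refine map_mem_supported _ (fun w hw => ?_) ha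
    rw [realize_single]
    refine single_mem_supported ℤ _ ⟨fun p => hσK _, fun p q => (hu ?_).le⟩
    exact (dist_affine_affine_le w p q hw).trans_lt hN
  obtain ⟨N, hN⟩ := ((Filter.eventually_all_finset c.support).2 hev).exists
  refine ⟨N, ?_⟩
  rw [← Module.End.coe_pow]
  simp only [← Module.End.coe_pow] at hN
  rw [← c.sum_single, Finsupp.sum, map_sum]
  refine Submodule.sum_mem _ fun σ hσ => ?_
  rw [← mul_one (c σ), ← smul_single', map_smul]
  exact Submodule.smul_mem _ _ (hN σ hσ)

end

/-! ### The cone operator of a strong Lipschitz contraction -/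

section

variable {k : ℕ}

theorem coneDenom_pos (a : ℝ) : 0 < max (1 - a) (1 / 2) := lt_max_of_lt_right (by norm_num)

/-- A Lipschitz retraction from the simplex to the face opposite to the zeroth vertex, which is the
radial projection where the zeroth coordinate is at most `1 / 2`. -/
def radial (t : stdSimplex ℝ (Fin (k + 2))) : stdSimplex ℝ (Fin (k + 1)) :=
  -- For `t 0 ≥ 1 / 2` the denominator is frozen at `1 / 2` to avoid the singularity at the vertex;
  -- the excess `t 0 - 1 / 2` placed on one coordinate restores the sum to `1`.
  ⟨fun i => (t i.succ + max (t 0 - 1 / 2) 0 * (Pi.single 0 1 : Fin (k + 1) → ℝ) i)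
      / max (1 - t 0) (1 / 2), by
    refine ⟨fun i => div_nonneg (add_nonneg (stdSimplex.zero_le t _)
      (mul_nonneg (le_max_right _ _) ?_)) (coneDenom_pos _).le, ?_⟩
    · rw [Pi.single_apply]; split_ifs <;> norm_num
    · rw [← Finset.sum_div, div_eq_one_iff_eq (coneDenom_pos _).ne', Finset.sum_add_distrib,
        ← Finset.mul_sum, Finset.sum_pi_single']
      have h := stdSimplex.sum_eq_one t
      rw [Fin.sum_univ_succ] at h
      rw [eq_sub_of_add_eq' h, if_pos (Finset.mem_univ _), mul_one]
      rcases le_total (t 0) (1 / 2) with h | h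
      · rw [max_eq_right (by linarith), max_eq_left (by linarith)]; ring
      · rw [max_eq_left (by linarith), max_eq_right (by linarith)]; ring⟩

theorem radial_apply (t : stdSimplex ℝ (Fin (k + 2))) (i : Fin (k + 1)) :
    radial t i = (t i.succ + max (t 0 - 1 / 2) 0 * (Pi.single 0 1 : Fin (k + 1) → ℝ) i)
      / max (1 - t 0) (1 / 2) := rfl

theorem radial_apply_of_le {t : stdSimplex ℝ (Fin (k + 2))} (ht : t 0 ≤ 1 / 2) (i : Fin (k + 1)) :
    radial t i = t i.succ / (1 - t 0) := by
  rw [radial_apply, max_eq_right (by linarith), max_eq_left (by linarith), zero_mul, add_zero]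

theorem radial_faceMap_zero (t : stdSimplex ℝ (Fin (k + 1))) : radial (faceMap k 0 t) = t := by
  ext i
  have h0 := faceMap_apply_self k 0 t
  rw [radial_apply_of_le (by rw [h0]; norm_num), h0, ← Fin.succAbove_zero,
    faceMap_apply_succAbove]
  simp

theorem faceMap_succ_zero (j : Fin (k + 2)) (t : stdSimplex ℝ (Fin (k + 2))) :
    faceMap (k + 1) j.succ t 0 = t 0 := by
  have h : (j.succ : Fin (k + 3)).succAbove (0 : Fin (k + 2)) = 0 := by simp
  conv_lhs => rw [← h]
  exact faceMap_apply_succAbove _ _ _ _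

/-- The restriction is needed because the extra mass always sits on coordinate `0`, which face maps
need not preserve. Where `t 0 ≥ 1 / 2` the cone is already constant. -/
theorem radial_faceMap_succ (j : Fin (k + 2)) {t : stdSimplex ℝ (Fin (k + 2))}
    (ht : t 0 ≤ 1 / 2) : radial (faceMap (k + 1) j.succ t) = faceMap k j (radial t) := by
  have h0 := faceMap_succ_zero j t
  ext i
  rw [radial_apply_of_le (by rwa [h0]), h0]
  rcases Fin.eq_self_or_eq_succAbove j i with rfl | ⟨l, rfl⟩
  · rw [faceMap_apply_self, faceMap_apply_self, zero_div]
  · rw [faceMap_apply_succAbove, radial_apply_of_le ht, ← Fin.succ_succAbove_succ,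
      faceMap_apply_succAbove]

theorem lipschitzWith_radial : LipschitzWith 6 (radial (k := k)) := by
  refine LipschitzWith.of_dist_le_mul fun s t => ?_
  rw [dist_le_iff_coord (by positivity)]
  intro i
  rw [radial_apply, radial_apply]
  set D := dist s t
  have h0 := abs_coord_sub_le s t 0
  have hi := abs_coord_sub_le s t i.succ
  set e : ℝ := (Pi.single 0 1 : Fin (k + 1) → ℝ) i
  have he : 0 ≤ e ∧ e ≤ 1 := by
    simp only [e, Pi.single_apply]; split_ifs <;> norm_num
  have hm : |max (s 0 - 1 / 2) 0 - max (t 0 - 1 / 2) 0| ≤ D :=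
    (abs_max_sub_max_le_abs _ _ _).trans (by simpa using h0)
  have hd : |max (1 - s 0) (1 / 2) - max (1 - t 0) (1 / 2)| ≤ D :=
    (abs_max_sub_max_le_abs _ _ _).trans (by rw [abs_sub_comm] at h0; simpa using h0)
  set a := s i.succ + max (s 0 - 1 / 2) 0 * e
  set b := t i.succ + max (t 0 - 1 / 2) 0 * e with hb
  have hba : 0 ≤ radial t i ∧ radial t i ≤ 1 := ⟨stdSimplex.zero_le _ _, stdSimplex.le_one _ _⟩
  rw [radial_apply, ← hb] at hba
  set p := max (1 - s 0) (1 / 2)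
  set q := max (1 - t 0) (1 / 2)
  have hp : 1 / 2 ≤ p := le_max_right _ _
  have hq : 1 / 2 ≤ q := le_max_right _ _
  have hab : |a - b| ≤ 2 * D := by
    have : a - b = (s i.succ - t i.succ) + (max (s 0 - 1 / 2) 0 - max (t 0 - 1 / 2) 0) * e := by
      simp only [a, b]; ring
    rw [this]
    refine (abs_add_le _ _).trans ?_
    rw [abs_mul, abs_of_nonneg he.1]
    have := mul_le_of_le_one_right (abs_nonneg (max (s 0 - 1 / 2) 0 - max (t 0 - 1 / 2) 0)) he.2
    linarith
  -- The numerator is `2`-Lipschitz, the denominator is `1`-Lipschitz and at least `1 / 2`, and `b /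
  -- q ≤ 1`; this yields `(2 + 1) / (1 / 2) = 6`.
  have key : a / p - b / q = ((a - b) - (p - q) * (b / q)) / p := by
    field_simp
    ring
  rw [key, abs_div, abs_of_pos (by linarith : 0 < p), div_le_iff₀ (by linarith)]
  have h3 : |(a - b) - (p - q) * (b / q)| ≤ 3 * D := by
    refine (abs_sub _ _).trans ?_
    rw [abs_mul, abs_of_nonneg hba.1]
    have := mul_le_of_le_one_right (abs_nonneg (p - q)) hba.2
    linarith
  have hD : 0 ≤ D := dist_nonneg
  change _ ≤ 6 * D * p
  nlinarith

/-- The time parameter of the cone. -/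
def coneTime (t : stdSimplex ℝ (Fin (k + 2))) : unitInterval :=
  -- The contraction starts at time `1` on the face opposite the apex and is finished at `t 0 = 1 /
  -- 2`, before `radial` stops being the radial projection.
  ⟨max 0 (1 - 2 * t 0), le_max_left _ _,
    max_le zero_le_one (by linarith [stdSimplex.zero_le t 0])⟩

theorem abs_coneTime_sub_le (s t : stdSimplex ℝ (Fin (k + 2))) :
    |(coneTime s : ℝ) - coneTime t| ≤ 2 * dist s t := by
  have h0 := abs_coord_sub_le s t 0
  have h1 : |(coneTime s : ℝ) - coneTime t| ≤ |(1 - 2 * s 0) - (1 - 2 * t 0)| := by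
    simp only [coneTime]
    rw [max_comm 0, max_comm 0]
    exact abs_max_sub_max_le_abs _ _ _
  have h2 : (1 - 2 * s 0) - (1 - 2 * t 0) = -2 * (s 0 - t 0) := by ring
  rw [h2, abs_mul, abs_neg, abs_two] at h1
  linarith

theorem coneTime_faceMap_zero (t : stdSimplex ℝ (Fin (k + 1))) : coneTime (faceMap k 0 t) = 1 := by
  ext
  simp [coneTime, faceMap_apply_self]

theorem coneTime_faceMap_succ (j : Fin (k + 2)) (t : stdSimplex ℝ (Fin (k + 2))) :
    coneTime (faceMap (k + 1) j.succ t) = coneTime t := by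
  ext
  simp [coneTime, faceMap_succ_zero]

theorem coneTime_eq_zero {t : stdSimplex ℝ (Fin (k + 2))} (ht : 1 / 2 ≤ t 0) : coneTime t = 0 := by
  ext
  simp only [coneTime, Set.Icc.coe_zero]
  exact max_eq_left (by linarith)

end

/-- The augmentation of the `0`-chains. -/
def augmentation (X : Type*) [TopologicalSpace X] : Chain 0 X →ₗ[ℤ] ℤ :=
  linearCombination ℤ fun _ => 1

theorem augmentation_boundary (X : Type*) [TopologicalSpace X] (c : Chain 1 X) :
    augmentation X (boundary X 0 c) = 0 := by
  refine induction_single (f := augmentation X ∘ₗ boundary X 0) (g := 0) (fun σ => ?_) c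
  simp [boundary_single, augmentation]

section

variable {X : Type*} [MetricSpace X]

theorem continuous_contraction {γ : ℝ} (hγ : 0 ≤ γ) {S : Set X} {φ : unitInterval → S → X}
    (hφ : ∀ (t t' : unitInterval) (s s' : S),
      dist (φ t s) (φ t' s') ≤ γ * Metric.diam S * |(t : ℝ) - (t' : ℝ)| + γ * dist s s') :
    Continuous fun p : unitInterval × S => φ p.1 p.2 := by
  have : LipschitzWith (Real.toNNReal (γ * Metric.diam S + γ))
      (fun p : unitInterval × S => φ p.1 p.2) := by
    refine LipschitzWith.of_dist_le_mul fun p q => (hφ _ _ _ _).trans ?_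
    have hd : 0 ≤ γ * Metric.diam S := mul_nonneg hγ Metric.diam_nonneg
    rw [Real.coe_toNNReal _ (by positivity), add_mul]
    have h1 : |(p.1 : ℝ) - q.1| ≤ dist p q := le_max_left _ _
    have h2 : dist p.2 q.2 ≤ dist p q := le_max_right _ _
    gcongr
  exact this.continuous

/-- The cone over a singular simplex with respect to a contraction. -/
def coneSimplex {S : Set X} (φ : unitInterval → S → X)
    (hφ : Continuous fun p : unitInterval × S => φ p.1 p.2) {k : ℕ} (τ : Simplex k X)
    (hτ : ∀ p, τ p ∈ S) : Simplex (k + 1) X where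
  toFun t := φ (coneTime t) ⟨τ (radial t), hτ _⟩
  continuous_toFun := by
    have h1 : Continuous (coneTime (k := k)) := by
      refine (LipschitzWith.of_dist_le_mul (K := 2) fun s t => ?_).continuous
      exact abs_coneTime_sub_le s t
    have h2 : Continuous fun t => (⟨τ (radial (k := k) t), hτ _⟩ : S) :=
      (τ.continuous.comp lipschitzWith_radial.continuous).subtype_mk _
    exact hφ.comp (h1.prodMk h2)

/-- A strong Lipschitz contraction of `S` induces a cone operator on the chains in `S`. -/
theorem exists_coneOperator {γ : ℝ} (hγ : 0 ≤ γ) {S : Set X}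
    (h : StrongLipschitzContraction γ S) :
    ∃ κ : ∀ k, Chain k X →ₗ[ℤ] Chain (k + 1) X,
      (∀ k, ∀ c ∈ chainsIn S (k + 1),
        boundary X (k + 1) (κ (k + 1) c) = c - κ k (boundary X k c)) ∧
      (∀ k y, boundary X k y ∈ chainsIn S k →
        boundary X k (κ k (boundary X k y)) = boundary X k y) ∧
      (∀ k, ∀ c ∈ lipChainsIn S k, κ k c ∈ lipChainsIn Set.univ (k + 1)) ∧
      ∀ x ρ, 0 ≤ ρ → S ⊆ Metric.closedBall x ρ → ∀ k, ∀ c ∈ chainsIn S k,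
        κ k c ∈ chainsIn (Metric.closedBall x ((1 + 2 * γ) * ρ)) (k + 1) := by
  classical
  obtain ⟨φ, x₀, h1, h0, hφ⟩ := h
  have hc := continuous_contraction hγ hφ
  -- Simplices that leave `S` are sent to the default value `0`; all four properties concern only
  -- chains in `S`.
  let κ : ∀ k, Chain k X →ₗ[ℤ] Chain (k + 1) X := fun k => linearCombination ℤ fun τ =>
    if hτ : ∀ p, τ p ∈ S then single (coneSimplex φ hc τ hτ) 1 else 0
  have hκ {k : ℕ} {τ : Simplex k X} (hτ : ∀ p, τ p ∈ S) :
      κ k (single τ 1) = single (coneSimplex φ hc τ hτ) 1 := by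
    simp only [κ, linearCombination_single, one_smul]
    rw [dif_pos hτ]
  have face_zero {k : ℕ} {τ : Simplex k X} (hτ : ∀ p, τ p ∈ S) :
      (coneSimplex φ hc τ hτ).comp (faceMap k 0) = τ := by
    ext t
    change φ (coneTime (faceMap k 0 t)) ⟨τ (radial (faceMap k 0 t)), _⟩ = τ t
    rw [coneTime_faceMap_zero, h1]
    simp only [radial_faceMap_zero]
  have face_succ {k : ℕ} {τ : Simplex (k + 1) X} (hτ : ∀ p, τ p ∈ S) (j : Fin (k + 2)) :
      (coneSimplex φ hc τ hτ).comp (faceMap (k + 1) j.succ)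
        = coneSimplex φ hc (τ.comp (faceMap k j)) (fun p => hτ _) := by
    ext t
    change φ (coneTime (faceMap (k + 1) j.succ t)) ⟨τ (radial (faceMap (k + 1) j.succ t)), _⟩
      = φ (coneTime t) ⟨τ (faceMap k j (radial t)), _⟩
    rw [coneTime_faceMap_succ]
    -- In the half away from the apex, faces commute with the radial projection; in the other half
    -- both sides equal `x₀`.
    rcases le_total (t 0) (1 / 2) with ht | ht
    · simp only [radial_faceMap_succ j ht]
    · rw [coneTime_eq_zero ht, h0, h0]
  have hbd : ∀ k, ∀ c ∈ chainsIn S (k + 1),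
      boundary X (k + 1) (κ (k + 1) c) = c - κ k (boundary X k c) := by
    intro k c hcS
    -- Chains supported on `∅` vanish, so an equality of linear maps on chains in `S` is checked on
    -- generators in `S`.
    have := map_mem_supported (s := {σ : Simplex (k + 1) X | ∀ p, σ p ∈ S}) (t := ∅)
      (boundary X (k + 1) ∘ₗ κ (k + 1) - (LinearMap.id - κ k ∘ₗ boundary X k)) (fun τ hτ => ?_) hcS
    · rw [supported_empty, Submodule.mem_bot] at this
      exact sub_eq_zero.1 this
    · rw [supported_empty, Submodule.mem_bot]
      have hsgn (j : Fin (k + 2)) : κ k (single (τ.comp (faceMap k j)) ((-1) ^ (j : ℕ)))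
          = (-1 : ℤ) ^ (j : ℕ) •
            single (coneSimplex φ hc (τ.comp (faceMap k j)) (fun p => hτ _)) 1 := by
        have := hκ (τ := τ.comp (faceMap k j)) (fun p => hτ _)
        rw [← mul_one ((-1 : ℤ) ^ (j : ℕ)), ← smul_single', map_smul, this, mul_one]
      simp only [LinearMap.sub_apply, LinearMap.comp_apply, LinearMap.id_apply, hκ hτ,
        boundary_single, map_sum, hsgn]
      rw [Fin.sum_univ_succ (n := k + 2)]
      simp only [face_zero, face_succ, Fin.val_zero, pow_zero, Fin.val_succ, pow_succ, mul_neg,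
        mul_one, single_neg, Finset.sum_neg_distrib, smul_single, smul_eq_mul]
      abel
  refine ⟨κ, hbd, fun k y hy => ?_, fun k c hcS => ?_, fun x ρ hρ hS k c hcS => ?_⟩
  · cases k with
    | succ k => rw [hbd k _ hy, boundary_boundary, map_zero, sub_zero]
    | zero =>
      -- In degree zero the cone formula has the extra term `x₀` times the augmentation, which
      -- vanishes on boundaries.
      have := map_mem_supported (s := {σ : Simplex 0 X | ∀ p, σ p ∈ S}) (t := ∅)
        (boundary X 0 ∘ₗ κ 0 - (LinearMap.id -
          (LinearMap.toSpanSingleton ℤ _ (single (ContinuousMap.const _ x₀) 1)) ∘ₗ augmentation X))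
        (fun τ hτ => ?_) hy
      · rw [supported_empty, Submodule.mem_bot] at this
        simp only [LinearMap.sub_apply, LinearMap.comp_apply, augmentation_boundary, map_zero,
          LinearMap.id_apply, sub_zero] at this
        exact sub_eq_zero.1 this
      · rw [supported_empty, Submodule.mem_bot]
        have hface : (coneSimplex φ hc τ hτ).comp (faceMap 0 1) = ContinuousMap.const _ x₀ := by
          ext t
          change φ (coneTime (faceMap 0 1 t)) _ = x₀
          have ht : faceMap 0 1 t 0 = 1 := by
            have := faceMap_apply_succAbove 0 1 t 0
            simpa using this
          rw [coneTime_eq_zero (by rw [ht]; norm_num), h0]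
        simp [hκ hτ, boundary_single, Fin.sum_univ_two, face_zero, hface, augmentation]
  · refine map_mem_supported _ (fun τ hτ => ?_) hcS
    obtain ⟨⟨K, hK⟩, hτ⟩ := hτ
    rw [hκ hτ]
    -- The factors `2` and `6` are the Lipschitz constants of `coneTime` and `radial`.
    refine single_mem_supported ℤ _ ⟨⟨Real.toNNReal (γ * Metric.diam S * 2 + γ * (K * 6)), ?_⟩,
      fun _ => trivial⟩
    refine LipschitzWith.of_dist_le_mul fun s t => (hφ _ _ _ _).trans ?_
    have hd : 0 ≤ γ * Metric.diam S := mul_nonneg hγ Metric.diam_nonneg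
    rw [Real.coe_toNNReal _ (by positivity), add_mul]
    have e1 := abs_coneTime_sub_le s t
    have e2 : dist (τ (radial s)) (τ (radial t)) ≤ K * 6 * dist s t :=
      (hK.comp lipschitzWith_radial).dist_le_mul s t
    rw [mul_assoc _ 2, mul_assoc γ (K * 6 : ℝ)]
    refine add_le_add ?_ (mul_le_mul_of_nonneg_left e2 hγ)
    gcongr
  · refine map_mem_supported _ (fun τ hτ => ?_) hcS
    rw [hκ hτ]
    refine single_mem_supported ℤ _ fun t => ?_
    rw [Metric.mem_closedBall]
    -- Up to time `1`, where it is the original point, a point moves at most `γ * diam S ≤ 2 * γ *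
    -- ρ`; hence the factor `1 + 2 * γ`.
    have e1 : dist (φ (coneTime t) ⟨τ (radial t), hτ _⟩) (τ (radial t)) ≤ γ * (2 * ρ) := by
      have := hφ (coneTime t) 1 ⟨τ (radial t), hτ _⟩ ⟨τ (radial t), hτ _⟩
      rw [h1, dist_self, mul_zero, add_zero] at this
      refine this.trans ?_
      have hdiam : Metric.diam S ≤ 2 * ρ :=
        (Metric.diam_mono hS Metric.isBounded_closedBall).trans (Metric.diam_closedBall hρ)
      have htime : |((coneTime t : unitInterval) : ℝ) - ((1 : unitInterval) : ℝ)| ≤ 1 := by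
        have := (coneTime t).2
        rw [Set.Icc.coe_one, abs_le]
        constructor <;> linarith [this.1, this.2]
      exact (mul_le_of_le_one_right (mul_nonneg hγ Metric.diam_nonneg) htime).trans
        (mul_le_mul_of_nonneg_left hdiam hγ)
    have e2 : dist (τ (radial t)) x ≤ ρ := hS (hτ _)
    change dist (φ (coneTime t) ⟨τ (radial t), hτ _⟩) x ≤ _
    linarith [dist_triangle (φ (coneTime t) ⟨τ (radial t), hτ _⟩) (τ (radial t)) x]

end

/-! ### Lipschitz approximation of small chains -/

section

variable {X : Type*}

theorem boundary_mem_supported [TopologicalSpace X] {k : ℕ} {s : Set (Simplex (k + 1) X)}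
    {t : Set (Simplex k X)} (h : ∀ σ ∈ s, ∀ j, σ.comp (faceMap k j) ∈ t) {c : Chain (k + 1) X}
    (hc : c ∈ supported ℤ ℤ s) : boundary X k c ∈ supported ℤ ℤ t := by
  refine map_mem_supported _ (fun σ hσ => ?_) hc
  rw [boundary_single]
  exact Submodule.sum_mem _ fun j _ => single_mem_supported ℤ _ (h σ hσ j)

theorem boundary_mem_chainsIn [TopologicalSpace X] {A : Set X} {k : ℕ} {c : Chain (k + 1) X}
    (hc : c ∈ chainsIn A (k + 1)) : boundary X k c ∈ chainsIn A k := by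
  refine boundary_mem_supported (fun _ hσ _ => ?_) hc
  exact fun _ => hσ _

theorem chainsIn_mono [TopologicalSpace X] {A B : Set X} (h : A ⊆ B) (k : ℕ) :
    chainsIn A k ≤ chainsIn B k :=
  supported_mono fun _ hσ p => h (hσ p)

theorem mem_chainsIn_univ [TopologicalSpace X] {k : ℕ} (c : Chain k X) :
    c ∈ chainsIn Set.univ k := by
  simp [chainsIn, supported_univ]

theorem boundary_mem_relCycles [TopologicalSpace X] (D : ∀ k, Submodule ℤ (Chain k X)) (k : ℕ)
    (y : Chain (k + 1) X) : boundary X k y ∈ relCycles (chainsIn Set.univ) D k := by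
  cases k with
  | zero => exact mem_chainsIn_univ _
  | succ k =>
    refine ⟨mem_chainsIn_univ _, ?_⟩
    change boundary X k (boundary X (k + 1) y) ∈ D k
    rw [boundary_boundary]
    exact zero_mem _

end

variable {X : Type*} [MetricSpace X]

theorem lipschitzWith_faceMap (k : ℕ) (j : Fin (k + 2)) : LipschitzWith 1 (faceMap k j) := by
  refine LipschitzWith.of_dist_le_mul fun s t => ?_
  rw [NNReal.coe_one, one_mul, dist_le_iff_coord dist_nonneg]
  intro i
  rcases Fin.eq_self_or_eq_succAbove j i with rfl | ⟨l, rfl⟩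
  · simp [faceMap_apply_self]
  · rw [faceMap_apply_succAbove, faceMap_apply_succAbove]
    exact abs_coord_sub_le s t l

theorem boundary_mem_lipChainsIn {A : Set X} {k : ℕ} {c : Chain (k + 1) X}
    (hc : c ∈ lipChainsIn A (k + 1)) : boundary X k c ∈ lipChainsIn A k := by
  refine boundary_mem_supported (fun _ hσ j => ?_) hc
  obtain ⟨⟨_, hK⟩, hA⟩ := hσ
  exact ⟨⟨_, hK.comp (lipschitzWith_faceMap k j)⟩, fun _ => hA _⟩

theorem boundary_mem_smallChains {K : Set X} {ε : ℝ} {k : ℕ} {c : Chain (k + 1) X}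
    (hc : c ∈ smallChains K ε (k + 1)) : boundary X k c ∈ smallChains K ε k := by
  refine boundary_mem_supported (fun _ hσ _ => ?_) hc
  exact ⟨fun _ => hσ.1 _, fun _ _ => hσ.2 _ _⟩

theorem lipChainsIn_mono {A B : Set X} (h : A ⊆ B) (k : ℕ) : lipChainsIn A k ≤ lipChainsIn B k :=
  supported_mono fun _ hσ => ⟨hσ.1, fun p => h (hσ.2 p)⟩

theorem mem_lipChainsIn_of_mem {A : Set X} {k : ℕ} {c : Chain k X}
    (h : c ∈ lipChainsIn Set.univ k) (h' : c ∈ chainsIn A k) : c ∈ lipChainsIn A k :=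
  (mem_supported ℤ c).2 fun _ hσ => ⟨((mem_supported ℤ c).1 h hσ).1, (mem_supported ℤ c).1 h' hσ⟩

/-- The domain of a `0`-simplex is a single point. This starts the inductive deformation with `P =
0`. -/
theorem lipChainsIn_univ_zero (c : Chain 0 X) : c ∈ lipChainsIn Set.univ 0 :=
  (mem_supported ℤ c).2 fun σ _ =>
    ⟨⟨0, LipschitzWith.of_dist_le_mul fun s t => by simp [Subsingleton.elim s t]⟩, fun _ => trivial⟩

theorem StrongLipschitzContraction.mono {γ γ' : ℝ} (h : γ ≤ γ') {S : Set X}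
    (hS : StrongLipschitzContraction γ S) : StrongLipschitzContraction γ' S := by
  obtain ⟨φ, x₀, h1, h0, hφ⟩ := hS
  refine ⟨φ, x₀, h1, h0, fun t t' s s' => (hφ t t' s s').trans ?_⟩
  have := Metric.diam_nonneg (s := S)
  gcongr

/-- The property passes to subsets and, with the smaller radius and larger constant, to finite
unions, so compactness reduces it to a neighbourhood of each point. -/
theorem LocallyStrongLipschitzContractions.exists_uniform
    (hX : LocallyStrongLipschitzContractions X) {K : Set X} (hK : IsCompact K) :
    ∃ δ > 0, ∃ γ > 0, ∀ x ∈ K, ∀ S ⊆ Metric.closedBall x δ, StrongLipschitzContraction γ S := by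
  refine hK.induction_on (p := fun K => ∃ δ > 0, ∃ γ > 0, ∀ x ∈ K, ∀ S ⊆ Metric.closedBall x δ,
    StrongLipschitzContraction γ S) ?_ ?_ ?_ ?_
  · exact ⟨1, one_pos, 1, one_pos, fun x hx => hx.elim⟩
  · rintro s t h ⟨δ, hδ, γ, hγ, H⟩
    exact ⟨δ, hδ, γ, hγ, fun x hx => H x (h hx)⟩
  · rintro s t ⟨δ, hδ, γ, hγ, H⟩ ⟨δ', hδ', γ', hγ', H'⟩
    refine ⟨min δ δ', lt_min hδ hδ', max γ γ', lt_max_of_lt_left hγ, fun x hx S hS => ?_⟩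
    rcases hx with hx | hx
    · exact (H x hx S (hS.trans (Metric.closedBall_subset_closedBall (min_le_left _ _)))).mono
        (le_max_left _ _)
    · exact (H' x hx S (hS.trans (Metric.closedBall_subset_closedBall (min_le_right _ _)))).mono
        (le_max_right _ _)
  · intro x _
    obtain ⟨r, hr, γ, hγ, H⟩ := hX x
    refine ⟨Metric.ball x (r / 2), mem_nhdsWithin_of_mem_nhds (Metric.ball_mem_nhds x (by linarith)),
      r / 3, by linarith, γ, hγ, fun y hy S hS => H S fun z hz => ?_⟩
    have h1 : dist z y ≤ r / 3 := hS hz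
    have h2 : dist y x < r / 2 := hy
    rw [Metric.mem_ball]
    linarith [dist_triangle z y x]

/-- On chains of sufficiently small simplices in `K` there are operators `P` which deform cycles
relative to the Lipschitz chains into Lipschitz chains. -/
theorem exists_deformation {K : Set X} {δ γ : ℝ} (hγ : 0 ≤ γ)
    (H : ∀ x ∈ K, ∀ S ⊆ Metric.closedBall x δ, StrongLipschitzContraction γ S) (k : ℕ) :
    ∃ C : ℝ, 0 ≤ C ∧ ∀ ε : ℝ, 0 ≤ ε → C * ε ≤ δ → ∃ P : Chain k X →ₗ[ℤ] Chain (k + 1) X,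
      (∀ c ∈ smallChains K ε k, c ∈ lipChainsIn Set.univ k → P c ∈ lipChainsIn Set.univ (k + 1)) ∧
      (∀ c ∈ smallChains K ε k, c ∈ relCycles (chainsIn Set.univ) (lipChainsIn Set.univ) k →
        c - boundary X k (P c) ∈ lipChainsIn Set.univ k) ∧
      ∀ σ : Simplex k X, (∀ p, σ p ∈ K) → (∀ p q, dist (σ p) (σ q) ≤ ε) →
        ∀ p, P (single σ 1) ∈ chainsIn (Metric.closedBall (σ p) (C * ε)) (k + 1) := by
  induction k with
  | zero =>
    exact ⟨0, le_rfl, fun ε _ _ => ⟨0, fun _ _ _ => zero_mem _,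
      fun c _ _ => lipChainsIn_univ_zero _, fun _ _ _ _ => zero_mem _⟩⟩
  | succ k ih =>
    obtain ⟨C, hC, ih⟩ := ih
    -- The simplex and `P` of its boundary lie within `(C + 1) * ε` of a vertex value; each of the
    -- two cones multiplies this by `1 + 2 * γ`, and the last `ε` moves the centre to an arbitrary
    -- `σ p`.
    refine ⟨(1 + 2 * γ) * ((1 + 2 * γ) * (C + 1)) + 1, by positivity, fun ε hε hδ => ?_⟩
    set ρ₀ := (C + 1) * ε with hρ₀
    set ρ₁ := (1 + 2 * γ) * ρ₀ with hρ₁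
    have h00 : 0 ≤ ρ₀ := by positivity
    have h01 : ρ₀ ≤ ρ₁ := le_mul_of_one_le_left h00 (by linarith)
    have h10 : 0 ≤ ρ₁ := h00.trans h01
    have h12 : ρ₁ ≤ (1 + 2 * γ) * ρ₁ := le_mul_of_one_le_left h10 (by linarith)
    have hρ : ((1 + 2 * γ) * ((1 + 2 * γ) * (C + 1)) + 1) * ε = (1 + 2 * γ) * ρ₁ + ε := by
      rw [hρ₁, hρ₀]; ring
    rw [hρ] at hδ ⊢
    have hCε : C * ε + ε = ρ₀ := by rw [hρ₀]; ring
    have hεC : 0 ≤ C * ε := by positivity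
    obtain ⟨P, hP1, hP2, hP3⟩ := ih ε hε (by linarith)
    have step : ∀ σ : Simplex (k + 1) X, ∃ Q : Chain (k + 2) X,
        (∀ p, σ p ∈ K) → (∀ p q, dist (σ p) (σ q) ≤ ε) →
        (single σ 1 - boundary X (k + 1) Q - P (boundary X k (single σ 1))
          ∈ lipChainsIn Set.univ (k + 1)) ∧
        (single σ 1 ∈ lipChainsIn Set.univ (k + 1) → Q ∈ lipChainsIn Set.univ (k + 2)) ∧
        ∀ p, Q ∈ chainsIn (Metric.closedBall (σ p) ((1 + 2 * γ) * ρ₁ + ε)) (k + 2) := by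
      intro σ
      by_cases hs : (∀ p, σ p ∈ K) ∧ ∀ p q, dist (σ p) (σ q) ≤ ε
      swap
      · exact ⟨0, fun h1 h2 => (hs ⟨h1, h2⟩).elim⟩
      obtain ⟨hσK, hσε⟩ := hs
      set x := σ (vertices (k + 1) 0) with hx
      obtain ⟨κ, -, hκ2, hκ3, hκ4⟩ := exists_coneOperator hγ (H x (hσK _)
        (Metric.closedBall x ρ₀) (Metric.closedBall_subset_closedBall (by linarith)))
      obtain ⟨κ', hκ'1, -, hκ'3, hκ'4⟩ := exists_coneOperator hγ (H x (hσK _)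
        (Metric.closedBall x ρ₁) (Metric.closedBall_subset_closedBall (by linarith)))
      have hσs : single σ 1 ∈ smallChains K ε (k + 1) := single_mem_supported ℤ _ ⟨hσK, hσε⟩
      have hσx : single σ 1 ∈ chainsIn (Metric.closedBall x ρ₀) (k + 1) :=
        single_mem_supported ℤ _ fun p => (hσε p _).trans (by linarith)
      have hPb : P (boundary X k (single σ 1)) ∈ chainsIn (Metric.closedBall x ρ₀) (k + 1) := by
        refine map_mem_supported (s := {τ : Simplex k X | ((∀ p, τ p ∈ K) ∧
          ∀ p q, dist (τ p) (τ q) ≤ ε) ∧ ∀ p, dist (τ p) x ≤ ε}) _ (fun τ hτ => ?_)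
          (boundary_mem_supported (s := {σ}) ?_ (single_mem_supported ℤ _ rfl))
        · refine chainsIn_mono ?_ _ (hP3 τ hτ.1.1 hτ.1.2 (vertices k 0))
          refine Metric.closedBall_subset_closedBall' ?_
          linarith [hτ.2 (vertices k 0)]
        · rintro _ rfl j
          exact ⟨⟨fun _ => hσK _, fun _ _ => hσε _ _⟩, fun _ => hσε _ _⟩
      set b := boundary X k (single σ 1) with hb
      -- This cycle has degree `k`, possibly zero, so it is filled using the cone property for
      -- boundaries.
      have hz : b - boundary X k (P b) = boundary X k (single σ 1 - P b) := by rw [map_sub]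
      have hzx : boundary X k (single σ 1 - P b) ∈ chainsIn (Metric.closedBall x ρ₀) k :=
        boundary_mem_chainsIn (sub_mem hσx hPb)
      have hzl : boundary X k (single σ 1 - P b) ∈ lipChainsIn Set.univ k := by
        rw [← hz]
        exact hP2 b (boundary_mem_smallChains hσs) (boundary_mem_relCycles _ _ _)
      set l := κ k (boundary X k (single σ 1 - P b)) with hl
      have hll : l ∈ lipChainsIn Set.univ (k + 1) := hκ3 _ _ (mem_lipChainsIn_of_mem hzl hzx)
      have hlx : l ∈ chainsIn (Metric.closedBall x ρ₁) (k + 1) :=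
        hκ4 x ρ₀ h00 subset_rfl _ _ hzx
      have hbl : boundary X k l = boundary X k (single σ 1 - P b) := hκ2 _ _ hzx
      -- The cycle `u` has positive degree `k + 1` and lies in the larger ball reached by `l`, so
      -- the second cone operator fills it.
      set u := single σ 1 - l - P b with hu
      have hsub := chainsIn_mono (X := X) (Metric.closedBall_subset_closedBall (x := x) h01) (k + 1)
      have hux : u ∈ chainsIn (Metric.closedBall x ρ₁) (k + 1) :=
        sub_mem (sub_mem (hsub hσx) hlx) (hsub hPb)
      have hbu : boundary X k u = 0 := by
        rw [hu, map_sub, map_sub, hbl, map_sub]; abel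
      have hbQ : boundary X (k + 1) (κ' (k + 1) u) = u := by
        rw [hκ'1 k u hux, hbu, map_zero, sub_zero]
      refine ⟨κ' (k + 1) u, fun _ _ => ⟨?_, fun hlip => ?_, fun p => ?_⟩⟩
      · rw [hbQ, hu]
        convert hll using 1
        abel
      · refine hκ'3 _ _ (mem_lipChainsIn_of_mem ?_ hux)
        exact sub_mem (sub_mem hlip hll)
          (hP1 b (boundary_mem_smallChains hσs) (boundary_mem_lipChainsIn hlip))
      · refine chainsIn_mono (Metric.closedBall_subset_closedBall' ?_) _
          (hκ'4 x ρ₁ h10 subset_rfl _ _ hux)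
        linarith [hσε (vertices (k + 1) 0) p]
    choose Q hQ using step
    have hQs (σ : Simplex (k + 1) X) : linearCombination ℤ Q (single σ 1) = Q σ := by simp
    refine ⟨linearCombination ℤ Q, fun c hc hl => ?_, fun c hc hcyc => ?_, fun σ h1 h2 p => ?_⟩
    · have hc' := (supported_inter (M := ℤ) (R := ℤ) _ _).ge ⟨hc, hl⟩
      refine map_mem_supported _ (fun σ hσ => ?_) hc'
      rw [hQs]
      exact (hQ σ hσ.1.1 hσ.1.2).2.1 (single_mem_supported ℤ _ hσ.2)
    · have h1 : (LinearMap.id (R := ℤ) (M := Chain (k + 1) X) - boundary X (k + 1) ∘ₗ linearCombination ℤ Q - P ∘ₗ boundary X k) c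
          ∈ lipChainsIn Set.univ (k + 1) := by
        refine map_mem_supported _ (fun σ hσ => ?_) hc
        simp only [LinearMap.sub_apply, LinearMap.comp_apply, LinearMap.id_apply, hQs]
        exact (hQ σ hσ.1 hσ.2).1
      have h2 := hP1 _ (boundary_mem_smallChains hc) hcyc.2
      have := add_mem h1 h2
      simpa using this
    · rw [hQs]
      exact (hQ σ h1 h2).2.2 p

/-! ### Comparison of the chain complexes -/

section

variable {X : Type*} [MetricSpace X]

/-- With `D` the subdivision homotopy, one step changes a chain by `∂Da + D∂a`, and `D∂a` is
Lipschitz because `∂a` is. -/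
theorem iterate_subdivision_homologous (k N : ℕ) (c : Chain k X)
    (hc : c ∈ relCycles (chainsIn Set.univ) (lipChainsIn Set.univ) k) :
    (subdivision k)^[N] c ∈ relCycles (chainsIn Set.univ) (lipChainsIn Set.univ) k ∧
      c - (subdivision k)^[N] c ∈ relBoundaries (chainsIn Set.univ) (lipChainsIn Set.univ) k := by
  induction N with
  | zero => exact ⟨hc, by simp⟩
  | succ N ih =>
    rw [Function.iterate_succ_apply']
    generalize (subdivision k)^[N] c = a at ih ⊢
    obtain ⟨ha, hca⟩ := ih
    have key : subdivision k a ∈ relCycles (chainsIn Set.univ) (lipChainsIn Set.univ) k ∧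
        a - subdivision k a ∈ relBoundaries (chainsIn Set.univ) (lipChainsIn Set.univ) k := by
      cases k with
      | zero =>
        refine ⟨mem_chainsIn_univ _, ?_⟩
        rw [← boundary_subdivisionHomotopy_zero]
        exact Submodule.mem_sup_right ⟨_, mem_chainsIn_univ _, rfl⟩
      | succ k =>
        refine ⟨⟨mem_chainsIn_univ _, ?_⟩, ?_⟩
        · change boundary X k (subdivision (k + 1) a) ∈ lipChainsIn Set.univ k
          rw [boundary_subdivision]
          exact subdivision_mem_lipChainsIn ha.2
        · rw [← boundary_subdivisionHomotopy]
          exact add_mem (Submodule.mem_sup_right ⟨_, mem_chainsIn_univ _, rfl⟩)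
            (Submodule.mem_sup_left (subdivisionHomotopy_mem_lipChainsIn ha.2))
    exact ⟨key.1, by simpa using add_mem hca key.2⟩

theorem exists_isCompact_chainsIn {k : ℕ} (c : Chain k X) :
    ∃ K : Set X, IsCompact K ∧ c ∈ chainsIn K k := by
  refine ⟨⋃ σ ∈ c.support, Set.range σ, c.support.isCompact_biUnion fun σ _ =>
    isCompact_range σ.continuous, (mem_supported ℤ c).2 fun σ hσ p => ?_⟩
  exact Set.mem_biUnion hσ ⟨p, rfl⟩

/-- Every singular chain with Lipschitz boundary is homologous to a Lipschitz chain. -/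
theorem LocallyStrongLipschitzContractions.relCycles_le (hX : LocallyStrongLipschitzContractions X)
    (k : ℕ) : relCycles (chainsIn (Set.univ : Set X)) (lipChainsIn Set.univ) k
      ≤ relBoundaries (chainsIn Set.univ) (lipChainsIn Set.univ) k := by
  intro c hc
  obtain ⟨K, hK, hcK⟩ := exists_isCompact_chainsIn c
  obtain ⟨δ, hδ, γ, hγ, H⟩ := hX.exists_uniform hK
  obtain ⟨C, hC, hP⟩ := exists_deformation hγ.le H k
  -- The `+ 1` keeps the quotient positive and defined when `C = 0`, while `C * ε ≤ δ`. The compact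
  -- `K` still contains all subdivided simplices.
  have hε : 0 < δ / (C + 1) := by positivity
  obtain ⟨P, -, hP, -⟩ := hP (δ / (C + 1)) hε.le (by
    rw [mul_div_assoc', div_le_iff₀ (by positivity)]; nlinarith)
  obtain ⟨N, hN⟩ := exists_iterate_subdivision_mem_smallChains hcK hε
  obtain ⟨h1, h2⟩ := iterate_subdivision_homologous k N c hc
  have h3 : (subdivision k)^[N] c ∈ relBoundaries (chainsIn Set.univ) (lipChainsIn Set.univ) k := by
    rw [← sub_add_cancel ((subdivision k)^[N] c) (boundary X k (P ((subdivision k)^[N] c)))]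
    exact add_mem (Submodule.mem_sup_left (hP _ hN h1))
      (Submodule.mem_sup_right ⟨_, mem_chainsIn_univ _, rfl⟩)
  simpa using add_mem h2 h3

/-! ### Transfer to the subspace `A` -/

/-- The inclusion of the chains of the subspace `A`. -/
def inclusionChain (A : Set X) (k : ℕ) : Chain k A →ₗ[ℤ] Chain k X :=
  lmapDomain ℤ ℤ fun σ => (⟨Subtype.val, continuous_subtype_val⟩ : C(A, X)).comp σ

theorem boundary_inclusionChain (A : Set X) (k : ℕ) (c : Chain (k + 1) A) :
    boundary X k (inclusionChain A (k + 1) c) = inclusionChain A k (boundary A k c) := by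
  refine induction_single (f := boundary X k ∘ₗ inclusionChain A (k + 1))
    (g := inclusionChain A k ∘ₗ boundary A k) (fun σ => ?_) c
  simp [boundary_single, inclusionChain, ContinuousMap.comp_assoc]

theorem inclusionChain_mem_chainsIn (A : Set X) (k : ℕ) (c : Chain k A) :
    inclusionChain A k c ∈ chainsIn A k := by
  refine map_mem_supported (s := Set.univ) _ (fun σ _ => ?_) (by simp [supported_univ])
  rw [inclusionChain, lmapDomain_apply, mapDomain_single]
  exact single_mem_supported ℤ _ fun p => (σ p).2

theorem exists_inclusionChain_eq {A : Set X} {k : ℕ} {c : Chain k X} (hc : c ∈ chainsIn A k) :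
    ∃ c', inclusionChain A k c' = c := by
  have : c ∈ (supported ℤ ℤ (Set.univ : Set (Simplex k A))).map (inclusionChain A k) := by
    rw [inclusionChain, lmapDomain_supported]
    refine supported_mono (fun σ hσ => ?_) hc
    exact ⟨⟨fun p => ⟨σ p, hσ p⟩, σ.continuous.subtype_mk _⟩, trivial, rfl⟩
  obtain ⟨c', -, h⟩ := this
  exact ⟨c', h⟩

theorem inclusionChain_mem_lipChainsIn_iff {A : Set X} {k : ℕ} {c : Chain k A} :
    inclusionChain A k c ∈ lipChainsIn A k ↔ c ∈ lipChainsIn Set.univ k := by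
  -- Distinct simplices of `A` stay distinct in `X`, so no coefficients cancel and the support of
  -- `c` survives.
  have hinj : Function.Injective fun σ : Simplex k A =>
      (⟨Subtype.val, continuous_subtype_val⟩ : C(A, X)).comp σ := fun σ τ h => by
    ext p
    exact congr($h p)
  constructor
  · intro h
    refine (mem_supported ℤ c).2 fun σ hσ => ⟨?_, fun _ => trivial⟩
    have : (⟨Subtype.val, continuous_subtype_val⟩ : C(A, X)).comp σ
        ∈ (inclusionChain A k c).support := by
      rw [mem_support_iff, inclusionChain, lmapDomain_apply, mapDomain_apply hinj]
      exact mem_support_iff.1 hσ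
    obtain ⟨⟨K, hK⟩, -⟩ := (mem_supported ℤ _).1 h this
    exact ⟨K, fun s t => hK s t⟩
  · refine map_mem_supported _ fun σ hσ => ?_
    rw [inclusionChain, lmapDomain_apply, mapDomain_single]
    obtain ⟨⟨K, hK⟩, -⟩ := hσ
    exact single_mem_supported ℤ _ ⟨⟨K, fun s t => hK s t⟩, fun p => (σ p).2⟩

theorem LocallyStrongLipschitzContractions.relCycles_le_of_subset {A : Set X}
    (hA : LocallyStrongLipschitzContractions A) (k : ℕ) :
    relCycles (chainsIn A) (lipChainsIn A) k ≤ relBoundaries (chainsIn A) (lipChainsIn A) k := by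
  intro c hc
  have hcA : c ∈ chainsIn A k := by
    cases k with
    | zero => exact hc
    | succ k => exact hc.1
  obtain ⟨a, rfl⟩ := exists_inclusionChain_eq hcA
  have ha : a ∈ relCycles (chainsIn Set.univ) (lipChainsIn Set.univ) k := by
    cases k with
    | zero => exact mem_chainsIn_univ _
    | succ k =>
      refine ⟨mem_chainsIn_univ _, ?_⟩
      have h : boundary X k (inclusionChain A (k + 1) a) ∈ lipChainsIn A k := hc.2
      rw [boundary_inclusionChain, inclusionChain_mem_lipChainsIn_iff] at h
      exact h
  obtain ⟨l, hl, _, ⟨e, -, rfl⟩, rfl⟩ := Submodule.mem_sup.1 (hA.relCycles_le k ha)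
  rw [map_add, ← boundary_inclusionChain]
  exact add_mem (Submodule.mem_sup_left (inclusionChain_mem_lipChainsIn_iff.2 hl))
    (Submodule.mem_sup_right ⟨_, inclusionChain_mem_chainsIn A _ _, rfl⟩)

end

end LipHom

end

/-! ### The diagram chase -/

theorem corollary1p6 {X : Type*} [MetricSpace X] (A : Set X)
    (hX : LipHom.LocallyStrongLipschitzContractions X)
    (hA : LipHom.LocallyStrongLipschitzContractions A) (k : ℕ) :
    Function.Bijective (LipHom.comparison A k) := by
  open LipHom in
  constructor
  · rw [← LinearMap.ker_eq_bot, LinearMap.ker_eq_bot']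
    intro q hq
    obtain ⟨⟨c, hc⟩, rfl⟩ := Submodule.Quotient.mk_surjective _ q
    have hb : c ∈ relBoundaries (chainsIn Set.univ) (chainsIn A) k :=
      (Submodule.Quotient.mk_eq_zero
        ((relBoundaries (chainsIn Set.univ) (chainsIn A) k).submoduleOf
          (relCycles (chainsIn Set.univ) (chainsIn A) k))).1 hq
    refine (Submodule.Quotient.mk_eq_zero _).2 ?_
    change c ∈ relBoundaries (lipChainsIn Set.univ) (lipChainsIn A) k
    obtain ⟨a, ha, _, ⟨e, -, rfl⟩, rfl⟩ := Submodule.mem_sup.1 hb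
    have haA : a ∈ relCycles (chainsIn A) (lipChainsIn A) k := by
      cases k with
      | zero => exact ha
      | succ k =>
        have h : boundary X k (a + boundary X (k + 1) e) ∈ lipChainsIn A k := hc.2
        rw [map_add, boundary_boundary, add_zero] at h
        exact ⟨ha, h⟩
    -- The part `a` in `A` has the Lipschitz boundary `∂c`, so acyclicity for `A` replaces it by a
    -- Lipschitz `l` up to `∂a'`.
    obtain ⟨l, hl, _, ⟨a', -, rfl⟩, rfl⟩ := Submodule.mem_sup.1 (hA.relCycles_le_of_subset k haA)
    have hcl : l + boundary X k a' + boundary X k e ∈ lipChainsIn Set.univ k := by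
      cases k with
      | zero => exact hc
      | succ k => exact hc.1
    -- Now `∂(a' + e) = c - l` is Lipschitz; acyclicity for `X`, one degree higher, replaces `a' +
    -- e` by a Lipschitz `l'` with the same boundary, so `c = l + ∂l'`.
    have he : a' + e ∈ relCycles (chainsIn Set.univ) (lipChainsIn Set.univ) (k + 1) := by
      refine ⟨mem_chainsIn_univ _, ?_⟩
      change boundary X k (a' + e) ∈ lipChainsIn Set.univ k
      have := sub_mem hcl (lipChainsIn_mono (Set.subset_univ A) k hl)
      rw [map_add]
      convert this using 1
      abel
    obtain ⟨l', hl', _, ⟨e', -, rfl⟩, h⟩ := Submodule.mem_sup.1 (hX.relCycles_le (k + 1) he)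
    have h' := congr(boundary X k $h)
    rw [map_add, boundary_boundary, add_zero, map_add] at h'
    rw [add_assoc, ← h']
    exact add_mem (Submodule.mem_sup_left hl) (Submodule.mem_sup_right ⟨l', hl', rfl⟩)
  · intro q
    obtain ⟨⟨c, hc⟩, rfl⟩ := Submodule.Quotient.mk_surjective _ q
    suffices h : ∃ l ∈ relCycles (lipChainsIn Set.univ) (lipChainsIn A) k,
        l - c ∈ relBoundaries (chainsIn Set.univ) (chainsIn A) k by
      obtain ⟨l, hl, h⟩ := h
      exact ⟨Submodule.Quotient.mk ⟨l, hl⟩, (Submodule.Quotient.eq _).2 h⟩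
    cases k with
    | zero =>
      obtain ⟨l, hl, _, ⟨e, -, rfl⟩, rfl⟩ := Submodule.mem_sup.1
        (hX.relCycles_le 0 (mem_chainsIn_univ c))
      refine ⟨l, hl, ?_⟩
      rw [sub_add_cancel_left]
      exact neg_mem (Submodule.mem_sup_right ⟨e, mem_chainsIn_univ _, rfl⟩)
    | succ k =>
      have hbc : boundary X k c ∈ relCycles (chainsIn A) (lipChainsIn A) k := by
        cases k with
        | zero => exact hc.2
        | succ k =>
          refine ⟨hc.2, ?_⟩
          change boundary X k (boundary X (k + 1) c) ∈ lipChainsIn A k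
          rw [boundary_boundary]
          exact zero_mem _
      -- Correcting `c` by the chain `a` in `A` makes its boundary the Lipschitz chain `l` of `A`;
      -- acyclicity for `X` then gives a Lipschitz `m` with `c - a = m + ∂e` and `∂m = l`.
      obtain ⟨l, hl, _, ⟨a, ha, rfl⟩, h⟩ := Submodule.mem_sup.1 (hA.relCycles_le_of_subset k hbc)
      have hl' : l = boundary X k (c - a) := by rw [map_sub, ← h, add_sub_cancel_right]
      have hca : c - a ∈ relCycles (chainsIn Set.univ) (lipChainsIn Set.univ) (k + 1) := by
        refine ⟨mem_chainsIn_univ _, ?_⟩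
        change boundary X k (c - a) ∈ lipChainsIn Set.univ k
        rw [← hl']
        exact lipChainsIn_mono (Set.subset_univ A) k hl
      obtain ⟨m, hm, _, ⟨e, -, rfl⟩, hme⟩ := Submodule.mem_sup.1 (hX.relCycles_le (k + 1) hca)
      refine ⟨m, ⟨hm, ?_⟩, ?_⟩
      · change boundary X k m ∈ lipChainsIn A k
        rw [← hme, map_add, boundary_boundary, add_zero] at hl'
        rwa [← hl']
      · have : m - c = -(a + boundary X (k + 1) e) := by
          rw [eq_sub_of_add_eq hme]; abel
        rw [this]
        exact neg_mem (add_mem (Submodule.mem_sup_left ha)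
          (Submodule.mem_sup_right ⟨e, mem_chainsIn_univ _, rfl⟩))
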